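/- Let $F$ be a field and $G$ an abelian group, written additively. A $G$-grading on an $F$-algebra $R$ is a decomposition $R=\bigoplus_{g\in G}R^{(g)}$ into subspaces with $R^{(g)}R^{(h)}\subset R^{(g+h)}$; a subalgebra $A\subset R$ is graded if $A=\bigoplus_g (A\cap R^{(g)})$, and then carries the induced grading; homomorphisms and isomorphisms of graded algebras are those preserving degrees. A graded algebra $C$ is a matrix algebra with elementary grading if there are $p$, an isomorphism $C\cong M_p(F)$ and a tuple $(g_1,\dots,g_p)\in G^p$ such that the matrix unit $E_{ij}$ lies in $C^{(g)}$ if and only if $g=g_j-g_i$. A graded algebra $D$ is a matrix algebra with fine grading if $D\cong M_q(F)$ for some $q$ and every nonzero component $D^{(g)}$ has dimension $1$. A decomposition $R=CD\cong C\otimes D$ of a graded algebra with identity $R$ consists of unital graded subalgebras $C,D\subset R$, where $C$ is a matrix algebra with elementary grading and $D$ is a matrix algebra with fine grading, which commute elementwise and for which the multiplication map $C\otimes_F D\to R$ is bijective. Let $R_1\cong M_k(F)$ and $R_2\cong M_n(F)$ be $G$-graded matrix algebras with identity elements $e_1$ and $e_2$, and let $R_1=C_1D_1$ and $R_2=C_2D_2$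 be decompositions in this sense, with $D_1\cong D_2$ as graded algebras. Let $\varphi:R_1\to R_2$ be an injective homomorphism of graded algebras (not necessarily with $\varphi(e_1)=e_2$). Then there exists a decomposition $R_2=\widetilde C_2\widetilde D_2\cong\widetilde C_2\otimes\widetilde D_2$ in the same sense such that $\widetilde D_2\cong D_2$ as graded algebras and $\varphi(C_1)\subset\widetilde C_2$; if $\varphi(e_1)R_2\varphi(e_1)=\varphi(R_1)$, then also $\varphi(e_1)\widetilde C_2\varphi(e_1)=\varphi(C_1)$. Moreover, for the same $\widetilde D_2$, there is an isomorphism of graded algebras $\psi:D_1\to\widetilde D_2$ such that $\varphi(a)\varphi(d)=\varphi(a)\psi(d)$ for all $a\in R_1$ and $d\in D_1$. -/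

import Mathlib

/-- The subalgebra `C` of the `G`-graded algebra `R = ⨁ g, 𝒜 g` (with `G` abelian, written
additively) is graded, and with the induced grading `g ↦ C ∩ 𝒜 g` it is a matrix algebra with
elementary grading: for some isomorphism `C ≅ M_p(F)` and some `p`-tuple `(g_1, …, g_p)` in `G`,
the matrix unit `E_ij` lies in the component of degree `g` iff `g = g_j - g_i`. -/
def IsElementaryGraded {F R G : Type*} [Field F] [Ring R] [Algebra F R] [AddCommGroup G]
    [DecidableEq G] (𝒜 : G → Submodule F R) [GradedAlgebra 𝒜] (C : Subalgebra F R) : Prop :=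
  DirectSum.SetLike.IsHomogeneous 𝒜 C ∧
    ∃ (p : ℕ) (e : C ≃ₐ[F] Matrix (Fin p) (Fin p) F) (γ : Fin p → G),
      ∀ (i j : Fin p) (g : G), (e.symm (Matrix.single i j 1) : R) ∈ 𝒜 g ↔ g = γ j - γ i

/-- The subalgebra `D` of the `G`-graded algebra `R` is graded, and with the induced grading it is
a matrix algebra with fine grading: every nonzero homogeneous component `D ∩ 𝒜 g` has
dimension one. -/
def IsFineGraded {F R G : Type*} [Field F] [Ring R] [Algebra F R] [AddCommGroup G]
    [DecidableEq G] (𝒜 : G → Submodule F R) [GradedAlgebra 𝒜] (D : Subalgebra F R) : Prop :=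
  DirectSum.SetLike.IsHomogeneous 𝒜 D ∧
    (∃ q : ℕ, Nonempty (D ≃ₐ[F] Matrix (Fin q) (Fin q) F)) ∧
      ∀ g : G, Subalgebra.toSubmodule D ⊓ 𝒜 g ≠ ⊥ →
        Module.finrank F ↥(Subalgebra.toSubmodule D ⊓ 𝒜 g) = 1

/-- A decomposition `R = CD ≅ C ⊗ D` of a graded algebra, where `C` has elementary grading, `D` has
fine grading, `C` and `D` commute elementwise, and the multiplication map `C ⊗ D → R` is
bijective. -/
structure IsGradedDecomposition {F R G : Type*} [Field F] [Ring R] [Algebra F R] [AddCommGroup G]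
    [DecidableEq G] (𝒜 : G → Submodule F R) [GradedAlgebra 𝒜] (C D : Subalgebra F R) : Prop where
  elementary : IsElementaryGraded 𝒜 C
  fine : IsFineGraded 𝒜 D
  commute : ∀ c ∈ C, ∀ d ∈ D, Commute c d
  bijective : Function.Bijective
    (Submodule.mulMap (Subalgebra.toSubmodule C) (Subalgebra.toSubmodule D))

/-- An algebra isomorphism between subalgebras of two `G`-graded algebras is an isomorphism of
graded algebras: it preserves and reflects degrees of homogeneous elements. -/
def IsGradedEquiv {F R S G : Type*} [Field F] [Ring R] [Algebra F R] [Ring S] [Algebra F S]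
    (𝒜 : G → Submodule F R) (ℬ : G → Submodule F S) {D : Subalgebra F R} {E : Subalgebra F S}
    (θ : D ≃ₐ[F] E) : Prop :=
  ∀ (g : G) (d : D), (d : R) ∈ 𝒜 g ↔ (θ d : S) ∈ ℬ g

/-! A diagonal matrix unit `ε` of `C₂` is a degree-zero idempotent with `ε R₂ ε = ε D₂`, a copy of
the graded division algebra `D₂`. A complete homogeneous dual system over it, that is `w_a v_b =
δ_ab ε` with `∑ v_a w_a = 1`, amounts to a decomposition of `R₂`: the `v_a w_b` are matrix units of
the elementary factor and `d ↦ ∑ v_a d w_a` embeds `D₂` as the fine factor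
(`exists_isGradedDecomposition_of_dualSystem`).

It remains to choose the system compatibly with `φ`. Let `E_ij` be the images of matrix units of
`C₁` and `θ : D₁ ≅ D₂`. The idempotent `E_oo` commutes with `φ(D₁)`, and it splits as `∑ v_x w_x`
with the extra property `φ(d) v_x = v_x θ(d)` (`exists_homogeneous_dual_system`): intertwiners arise
by averaging over matrix units, their homogeneous components still intertwine, and the graded
division property inverts them. Transporting by `E_io` and adjoining a splitting of `1 - φ(1)` gives
a complete system. It satisfies `E_ij = ∑_x V_(i,x) W_(j,x)`, so `φ(C₁)` lies in the elementary
factor, and the intertwining property gives `φ(1) ψ(d) = φ(d)`. The corner equality follows because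
`C₁` contains the centralizer of `D₁`. -/

/-! ### Matrix units and primeness -/

theorem matrixUnits_mul {F R q : Type*} [Field F] [Ring R] [Algebra F R] [Fintype q]
    [DecidableEq q] {S : Subalgebra F R} (e : S ≃ₐ[F] Matrix q q F) (i j k l : q) :
    (e.symm (Matrix.single i j 1) : R) * e.symm (Matrix.single k l 1) =
      if j = k then (e.symm (Matrix.single i l 1) : R) else 0 := by
  rw [← S.coe_mul, ← map_mul]
  split_ifs with h
  · subst h
    rw [Matrix.single_mul_single_same, mul_one]
  · rw [Matrix.single_mul_single_of_ne _ _ _ _ h, map_zero, S.coe_zero]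

theorem matrixUnits_sum {F R q : Type*} [Field F] [Ring R] [Algebra F R] [Fintype q]
    [DecidableEq q] {S : Subalgebra F R} (e : S ≃ₐ[F] Matrix q q F) :
    ∑ i, (e.symm (Matrix.single i i 1) : R) = 1 := by
  have h : ∑ i : q, Matrix.single i i (1 : F) = 1 := by
    ext a b
    simp [Matrix.sum_apply, Matrix.single_apply, Matrix.one_apply, ite_and]
  calc _ = ((e.symm (∑ i, Matrix.single i i (1 : F)) : S) : R) := by
        rw [map_sum, AddSubmonoidClass.coe_finsetSum]
    _ = 1 := by rw [h, map_one, S.coe_one]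

theorem matrixUnits_corner {F R q : Type*} [Field F] [Ring R] [Algebra F R] [Fintype q]
    [DecidableEq q] {S : Subalgebra F R} (e : S ≃ₐ[F] Matrix q q F) (s : S) (i k l j : q) :
    (e.symm (Matrix.single i k 1) : R) * s * e.symm (Matrix.single l j 1) =
      e s k l • (e.symm (Matrix.single i j 1) : R) := by
  have h : Matrix.single i k 1 * e s * Matrix.single l j 1 =
      e s k l • Matrix.single i j (1 : F) := by
    ext a b
    simp only [Matrix.mul_apply, Matrix.single_apply, Matrix.smul_apply, smul_eq_mul]
    simp [ite_and, Finset.sum_ite_eq]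
    split_ifs <;> simp_all
  have h' := congrArg (fun x => ((e.symm x : S) : R)) h
  simp only [map_mul, map_smul, AlgEquiv.symm_apply_apply] at h'
  exact h'

theorem matrixUnits_decompose {F R q : Type*} [Field F] [Ring R] [Algebra F R] [Fintype q]
    [DecidableEq q] {S : Subalgebra F R} (e : S ≃ₐ[F] Matrix q q F) (s : S) :
    (s : R) = ∑ i, ∑ j, e s i j • (e.symm (Matrix.single i j 1) : R) := by
  have h := Matrix.matrix_eq_sum_single (e s)
  have h' := congrArg (fun x => S.val (e.symm x)) h
  simp only [map_sum, AlgEquiv.symm_apply_apply] at h'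
  rw [Subalgebra.coe_val] at h'
  rw [h']
  refine Finset.sum_congr rfl fun i _ => Finset.sum_congr rfl fun j _ => ?_
  rw [← S.coe_smul, ← map_smul, Matrix.smul_single, smul_eq_mul, mul_one]

theorem exists_mul_mul_ne_zero_of_algEquiv_matrix {F R q : Type*} [Field F] [Ring R] [Algebra F R]
    [Fintype q] [DecidableEq q] (e : R ≃ₐ[F] Matrix q q F) {x y : R} (hx : x ≠ 0) (hy : y ≠ 0) :
    ∃ r, x * r * y ≠ 0 := by
  have hx' : e x ≠ 0 := by simpa using hx
  have hy' : e y ≠ 0 := by simpa using hy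
  obtain ⟨i, j, hij⟩ : ∃ i j, e x i j ≠ 0 := by
    by_contra! h
    exact hx' (Matrix.ext h)
  obtain ⟨k, l, hkl⟩ : ∃ i j, e y i j ≠ 0 := by
    by_contra! h
    exact hy' (Matrix.ext h)
  refine ⟨e.symm (Matrix.single j k 1), fun h => ?_⟩
  have h' := congrArg (fun z => e z i l) h
  simp [Matrix.mul_apply, Matrix.single_apply, ite_and, Finset.sum_ite_eq] at h'
  simp_all

/-! ### Homogeneous components and inverses in fine gradings -/

theorem eq_sum_decompose {F R G : Type*} [Field F] [Ring R] [Algebra F R] [AddCommGroup G]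
    [DecidableEq G] (ℬ : G → Submodule F R) [GradedAlgebra ℬ] (x : R) :
    ∃ s : Finset G, x = ∑ g ∈ s, (DirectSum.decompose ℬ x g : R) := by
  classical
  exact ⟨_, (DirectSum.sum_support_decompose ℬ x).symm⟩

theorem decompose_sum_coe {F R G κ : Type*} [Field F] [Ring R] [Algebra F R] [AddCommGroup G]
    [DecidableEq G] (ℬ : G → Submodule F R) [GradedAlgebra ℬ] (s : Finset κ) (f : κ → R) (g : G) :
    (DirectSum.decompose ℬ (∑ i ∈ s, f i) g : R) = ∑ i ∈ s, (DirectSum.decompose ℬ (f i) g : R) :=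
  map_sum (GradedRing.proj ℬ g) f s

theorem exists_decompose_ne_zero {F R G : Type*} [Field F] [Ring R] [Algebra F R] [AddCommGroup G]
    [DecidableEq G] (ℬ : G → Submodule F R) [GradedAlgebra ℬ] {x : R} (hx : x ≠ 0) :
    ∃ g, (DirectSum.decompose ℬ x g : R) ≠ 0 := by
  by_contra! h
  obtain ⟨s, hs⟩ := eq_sum_decompose ℬ x
  exact hx (hs.trans (Finset.sum_eq_zero fun g _ => h g))

/-- Nonzero homogeneous elements of a matrix algebra with fine grading are invertible. -/
theorem IsFineGraded.exists_left_inverse {F R G : Type*} [Field F] [Ring R] [Algebra F R]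
    [AddCommGroup G] [DecidableEq G] {ℬ : G → Submodule F R} [GradedAlgebra ℬ]
    {D : Subalgebra F R} (hD : IsFineGraded ℬ D) {d : R} {g : G} (hdD : d ∈ D) (hdg : d ∈ ℬ g)
    (hd0 : d ≠ 0) : ∃ d' ∈ D, d' * d = 1 := by
  obtain ⟨hhom, ⟨q, ⟨e⟩⟩, hfine⟩ := hD
  -- Otherwise every element of `D d D` has zero component in degree 0; but `D` is simple, so `1` is
  -- in `D d D`, and `1` has degree 0.
  have key : ∃ a ∈ D, ∃ b ∈ D, a * d * b ∈ ℬ 0 ∧ a * d * b ≠ 0 := by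
    by_contra! hcon
    have hzero : ∀ a ∈ D, ∀ b ∈ D, (DirectSum.decompose ℬ (a * d * b) 0 : R) = 0 := by
      intro a ha b hb
      obtain ⟨s, hs⟩ := eq_sum_decompose ℬ a
      obtain ⟨t, ht⟩ := eq_sum_decompose ℬ b
      have : a * d * b = ∑ i ∈ s, ∑ j ∈ t,
          (DirectSum.decompose ℬ a i : R) * d * DirectSum.decompose ℬ b j := by
        conv_lhs => rw [hs, ht]
        simp_rw [Finset.sum_mul, Finset.mul_sum]
      rw [this]
      simp only [decompose_sum_coe]
      refine Finset.sum_eq_zero fun i _ => Finset.sum_eq_zero fun j _ => ?_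
      have hm : (DirectSum.decompose ℬ a i : R) * d * DirectSum.decompose ℬ b j ∈ ℬ (i + g + j) :=
        SetLike.mul_mem_graded (SetLike.mul_mem_graded (SetLike.coe_mem _) hdg) (SetLike.coe_mem _)
      by_cases h : i + g + j = 0
      · rw [h] at hm
        rw [hcon _ (hhom i ha) _ (hhom j hb) hm]
        simp
      · exact DirectSum.decompose_of_mem_ne ℬ hm h
    have hd' : e ⟨d, hdD⟩ ≠ 0 := by
      simpa [Subtype.ext_iff] using hd0
    obtain ⟨k, l, hkl⟩ : ∃ i j, e ⟨d, hdD⟩ i j ≠ 0 := by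
      by_contra! h
      exact hd' (Matrix.ext h)
    have h1 : (1 : R) = ∑ i, ((e ⟨d, hdD⟩ k l)⁻¹ • (e.symm (Matrix.single i k 1) : R)) * d *
        e.symm (Matrix.single l i 1) := by
      rw [← matrixUnits_sum e]
      refine Finset.sum_congr rfl fun i _ => ?_
      have := matrixUnits_corner e ⟨d, hdD⟩ i k l i
      rw [smul_mul_assoc, smul_mul_assoc, this, smul_smul, inv_mul_cancel₀ hkl, one_smul]
    have h2 : (DirectSum.decompose ℬ (1 : R) 0 : R) = 0 := by
      rw [h1]
      rw [decompose_sum_coe]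
      exact Finset.sum_eq_zero fun i _ =>
        hzero _ (D.smul_mem (SetLike.coe_mem _) _) _ (SetLike.coe_mem _)
    rw [DirectSum.decompose_of_mem_same ℬ SetLike.GradedOne.one_mem] at h2
    exact hd0 (by rw [← mul_one d, h2, mul_zero])
  obtain ⟨a, ha, b, hb, h0, hne⟩ := key
  have h10 : (1 : R) ≠ 0 := fun h => hd0 (by rw [← mul_one d, h, mul_zero])
  -- Fineness in degree 0 says `D ∩ ℬ 0 = F · 1`, so `a * d * b` is a nonzero scalar.
  let one' : ↥(Subalgebra.toSubmodule D ⊓ ℬ 0) := ⟨1, D.one_mem, SetLike.GradedOne.one_mem⟩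
  have hone : one' ≠ 0 := fun h => h10 (congrArg Subtype.val h)
  have hfr := hfine 0 (fun h => hone (by
    exact Subtype.ext ((Submodule.mem_bot F).1 (h ▸ one'.2 : one'.1 ∈ (⊥ : Submodule F R)))))
  obtain ⟨c, hc⟩ := (finrank_eq_one_iff_of_nonzero' one' hone).1 hfr
    ⟨a * d * b, D.mul_mem (D.mul_mem ha hdD) hb, h0⟩
  have hc' : c • (1 : R) = a * d * b := congrArg Subtype.val hc
  have hc0 : c ≠ 0 := by
    rintro rfl
    exact hne (by rw [← hc', zero_smul])
  have h1 : (⟨a * d, D.mul_mem ha hdD⟩ : D) * (c⁻¹ • ⟨b, hb⟩) = 1 := by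
    refine Subtype.ext ?_
    change a * d * (c⁻¹ • b) = 1
    rw [mul_smul_comm, ← hc', smul_smul, inv_mul_cancel₀ hc0, one_smul]
  have h2 : (c⁻¹ • ⟨b, hb⟩ : D) * ⟨a * d, D.mul_mem ha hdD⟩ = 1 := by
    apply e.injective
    have := congrArg e h1
    rw [map_mul, map_one] at this ⊢
    exact mul_eq_one_comm.1 this
  refine ⟨(c⁻¹ • b) * a, D.mul_mem (D.smul_mem hb _) ha, ?_⟩
  have := congrArg Subtype.val h2
  rw [mul_assoc]
  exact this

/-! ### Splitting a homogeneous idempotent -/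

/-- A homogeneous idempotent `h` commuting with the matrix units `A` splits into homogeneous
rank-one pieces `v a * w a`, equivalent to `ε` and intertwining `A` with the matrix units `B`. -/
theorem exists_homogeneous_dual_system {F R G ι : Type*} [Field F] [Ring R] [Algebra F R]
    [FiniteDimensional F R] [AddCommGroup G] [DecidableEq G] [Fintype ι] [DecidableEq ι]
    (ℬ : G → Submodule F R) [GradedAlgebra ℬ]
    (hprime : ∀ x y : R, x ≠ 0 → y ≠ 0 → ∃ r, x * r * y ≠ 0)
    (o : ι) (A B : ι → ι → R)
    (hA : ∀ i j k l, A i j * A k l = if j = k then A i l else 0)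
    (hB : ∀ i j k l, B i j * B k l = if j = k then B i l else 0)
    (hB1 : ∑ i, B i i = 1)
    (hl : ∀ v, (∀ i j, A i j * v = v * B i j) → ∀ g i j,
      A i j * (DirectSum.decompose ℬ v g : R) = DirectSum.decompose ℬ v g * B i j)
    (hr : ∀ w, (∀ i j, B i j * w = w * A i j) → ∀ g i j,
      B i j * (DirectSum.decompose ℬ w g : R) = DirectSum.decompose ℬ w g * A i j)
    (ε : R) (hε0 : ε ∈ ℬ 0) (hεε : ε * ε = ε) (hε : ε ≠ 0) (hBε : ∀ i j, B i j * ε = ε * B i j)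
    (hdiv : ∀ g, ∀ v ∈ ℬ g, v ≠ 0 → v * ε = v → ∃ y, y * v = ε)
    (h : R) (hh0 : h ∈ ℬ 0) (hhh : h * h = h) (hAh : ∀ i j, A i j * h = h * A i j)
    (hh1 : h * ∑ i, A i i = h) :
    ∃ (s : ℕ) (v w : Fin s → R) (γ : Fin s → G),
      (∀ a, v a ∈ ℬ (γ a)) ∧ (∀ a, w a ∈ ℬ (-γ a)) ∧
      (∀ a, v a * ε = v a) ∧ (∀ a, ε * w a = w a) ∧
      (∀ a, h * v a = v a) ∧ (∀ a, w a * h = w a) ∧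
      (∀ a i j, A i j * v a = v a * B i j) ∧ (∀ a i j, B i j * w a = w a * A i j) ∧
      (∀ a b, w a * v b = if a = b then ε else 0) ∧ ∑ a, v a * w a = h := by
  -- Induction on the right ideal `hR`, which shrinks strictly when a rank-one piece is removed.
  generalize hP : LinearMap.range (LinearMap.mulLeft F h) = P
  induction P using WellFoundedLT.induction generalizing h with
  | ind P ih =>
  by_cases hz : h = 0
  · subst hz
    exact ⟨0, Fin.elim0, Fin.elim0, Fin.elim0, by simp⟩
  have hAo : h * A o o ≠ 0 := by
    intro hc
    apply hz
    rw [← hh1, Finset.mul_sum]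
    refine Finset.sum_eq_zero fun i _ => ?_
    have : A i i = A i o * A o o * A o i := by simp [hA]
    rw [this, ← mul_assoc, ← mul_assoc, ← hAh, mul_assoc (A i o), hc, mul_zero, zero_mul]
  have hBo : B o o * ε ≠ 0 := by
    intro hc
    apply hε
    rw [← one_mul ε, ← hB1, Finset.sum_mul]
    refine Finset.sum_eq_zero fun i _ => ?_
    have : B i i = B i o * B o o * B o i := by simp [hB]
    rw [this, mul_assoc, hBε, ← mul_assoc, mul_assoc _ _ ε, hc, mul_zero, zero_mul]
  obtain ⟨x, hx⟩ := hprime _ _ hAo hBo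
  -- Averaging over the matrix units makes any element an intertwiner; this one is nonzero because
  -- `A o o * v' * B o o` recovers the nonzero product chosen by primeness.
  obtain ⟨v', hv'⟩ : ∃ v', v' = ∑ i, A i o * (h * x * ε) * B o i := ⟨_, rfl⟩
  have hv'A : ∀ k l, A k l * v' = v' * B k l := by
    intro k l
    rw [hv', Finset.mul_sum, Finset.sum_mul]
    simp only [← mul_assoc, hA]
    simp only [mul_assoc, hB]
    simp
  have hv'h : h * v' = v' := by
    rw [hv', Finset.mul_sum]
    refine Finset.sum_congr rfl fun i _ => ?_
    simp only [← mul_assoc]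
    rw [← hAh, mul_assoc _ h h, hhh]
  have hv'ε : v' * ε = v' := by
    rw [hv', Finset.sum_mul]
    refine Finset.sum_congr rfl fun i _ => ?_
    simp only [mul_assoc]
    rw [hBε, ← mul_assoc ε ε, hεε]
  have hv'0 : v' ≠ 0 := by
    intro hc
    apply hx
    have h1 : A o o * v' * B o o = 0 := by rw [hc, mul_zero, zero_mul]
    rw [hv', Finset.mul_sum, Finset.sum_mul] at h1
    simp only [← mul_assoc, hA] at h1
    simp only [mul_assoc, hB] at h1
    rw [Finset.sum_eq_single o (fun b _ hb => by rw [if_neg hb.symm, zero_mul])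
      (fun hn => (hn (Finset.mem_univ o)).elim), if_pos rfl, if_pos rfl, ← hBε, ← mul_assoc,
      hAh] at h1
    simpa only [mul_assoc] using h1
  -- A homogeneous component keeps the intertwining by `hl`, and keeps `h v = v` and `v ε = v`
  -- because `h` and `ε` have degree 0.
  obtain ⟨g, hg⟩ := exists_decompose_ne_zero ℬ hv'0
  obtain ⟨v, hv⟩ : ∃ v : R, v = DirectSum.decompose ℬ v' g := ⟨_, rfl⟩
  rw [← hv] at hg
  have hvg : v ∈ ℬ g := hv ▸ SetLike.coe_mem _
  have hvA : ∀ k l, A k l * v = v * B k l := fun k l => by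
    rw [hv]
    exact hl v' hv'A g k l
  have hvh : h * v = v := by
    rw [hv, ← DirectSum.coe_decompose_mul_of_left_mem_zero ℬ hh0, hv'h]
  have hvε : v * ε = v := by
    rw [hv, ← DirectSum.coe_decompose_mul_of_right_mem_zero ℬ hε0, hv'ε]
  obtain ⟨y, hy⟩ := hdiv g v hvg hg hvε
  -- The left inverse `y` need not intertwine; its average does, and it still sends `v` to `ε`.
  obtain ⟨w', hw'⟩ : ∃ w', w' = ∑ i, B i o * (ε * y * h) * A o i := ⟨_, rfl⟩
  have hw'B : ∀ k l, B k l * w' = w' * A k l := by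
    intro k l
    rw [hw', Finset.mul_sum, Finset.sum_mul]
    simp only [← mul_assoc, hB]
    simp only [mul_assoc, hA]
    simp
  have hw'h : w' * h = w' := by
    rw [hw', Finset.sum_mul]
    refine Finset.sum_congr rfl fun i _ => ?_
    simp only [mul_assoc]
    rw [hAh, ← mul_assoc h h, hhh]
  have hw'ε : ε * w' = w' := by
    rw [hw', Finset.mul_sum]
    refine Finset.sum_congr rfl fun i _ => ?_
    simp only [← mul_assoc]
    rw [← hBε, mul_assoc _ ε ε, hεε]
  have hw'v : w' * v = ε := by
    rw [hw', Finset.sum_mul]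
    calc _ = ∑ i, B i i * ε := by
          refine Finset.sum_congr rfl fun i _ => ?_
          rw [mul_assoc, hvA, mul_assoc (B i o), mul_assoc (ε * y), ← mul_assoc h v, hvh,
            mul_assoc ε, ← mul_assoc y, hy, ← mul_assoc ε ε, hεε, ← hBε, ← mul_assoc, hB, if_pos rfl]
      _ = ε := by rw [← Finset.sum_mul, hB1, one_mul]
  -- As `v` has degree `g` and `w' * v = ε` has degree 0, the component of degree `-g` alone yields
  -- `ε`.
  obtain ⟨w, hw⟩ : ∃ w : R, w = DirectSum.decompose ℬ w' (-g) := ⟨_, rfl⟩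
  have hwg : w ∈ ℬ (-g) := hw ▸ SetLike.coe_mem _
  have hwB : ∀ k l, B k l * w = w * A k l := fun k l => by
    rw [hw]
    exact hr w' hw'B _ k l
  have hwh : w * h = w := by
    rw [hw, ← DirectSum.coe_decompose_mul_of_right_mem_zero ℬ hh0, hw'h]
  have hwε : ε * w = w := by
    rw [hw, ← DirectSum.coe_decompose_mul_of_left_mem_zero ℬ hε0, hw'ε]
  have hwv : w * v = ε := by
    have := DirectSum.coe_decompose_mul_add_of_right_mem ℬ (i := -g) (a := w') hvg
    rw [hw'v, neg_add_cancel, DirectSum.decompose_of_mem_same ℬ hε0] at this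
    rw [hw, ← this]
  have hvwv : v * w * v = v := by rw [mul_assoc, hwv, hvε]
  have hwvw : w * v * w = w := by rw [hwv, hwε]
  obtain ⟨h', hh'⟩ : ∃ h', h' = h - v * w := ⟨_, rfl⟩
  have hh'v : h' * v = 0 := by rw [hh', sub_mul, hvh, hvwv, sub_self]
  have hwh' : w * h' = 0 := by rw [hh', mul_sub, hwh, ← mul_assoc, hwvw, sub_self]
  have hh'h : h' * h = h' := by rw [hh', sub_mul, hhh, mul_assoc, hwh]
  have hhh' : h * h' = h' := by rw [hh', mul_sub, hhh, ← mul_assoc, hvh]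
  have hvw0 : v * w ∈ ℬ 0 := by
    have := SetLike.mul_mem_graded hvg hwg
    rwa [add_neg_cancel] at this
  have hlt : LinearMap.range (LinearMap.mulLeft F h') < P := by
    rw [← hP]
    refine lt_of_le_of_ne ?_ ?_
    · rintro _ ⟨z, rfl⟩
      exact ⟨h' * z, by simp only [LinearMap.mulLeft_apply]; rw [← mul_assoc, hhh']⟩
    -- Strictness: `v` lies in `hR`, but the idempotent `h'` kills `v`, so `v` in `h'R` would force
    -- `v = 0`.
    · intro hc
      have hmem : v ∈ LinearMap.range (LinearMap.mulLeft F h) := ⟨v, hvh⟩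
      rw [← hc] at hmem
      obtain ⟨z, hz'⟩ := hmem
      simp only [LinearMap.mulLeft_apply] at hz'
      apply hg
      have h3 : h' * h' = h' := by
        conv_lhs => rw [hh', mul_sub, ← mul_assoc]
        rw [← hh', hh'h, hh'v, zero_mul, sub_zero]
      rw [← hz', ← h3, mul_assoc, hz', hh'v]
  obtain ⟨s, V, W, γ, hV, hW, hVε, hWε, hVh, hWh, hVA, hWB, hWV, hsum⟩ :=
    ih _ hlt h' (hh' ▸ Submodule.sub_mem _ hh0 hvw0)
      (by conv_lhs => rw [hh', mul_sub, ← mul_assoc]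
          rw [← hh', hh'h, hh'v, zero_mul, sub_zero])
      (fun i j => by
        rw [hh', mul_sub, sub_mul, hAh, ← mul_assoc, hvA, mul_assoc v, hwB, ← mul_assoc])
      (by rw [← hh'h, mul_assoc, hh1]) rfl
  refine ⟨s + 1, Fin.cons v V, Fin.cons w W, Fin.cons g γ, ?_, ?_, ?_, ?_, ?_, ?_, ?_, ?_, ?_, ?_⟩
  · exact Fin.cases hvg hV
  · exact Fin.cases hwg hW
  · exact Fin.cases hvε hVε
  · exact Fin.cases hwε hWε
  · refine Fin.cases hvh fun a => ?_
    rw [Fin.cons_succ, ← hVh a, ← mul_assoc, hhh']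
  · refine Fin.cases hwh fun a => ?_
    rw [Fin.cons_succ, ← hWh a, mul_assoc, hh'h]
  · exact Fin.cases hvA hVA
  · exact Fin.cases hwB hWB
  · refine Fin.cases (Fin.cases ?_ fun b => ?_) fun a => Fin.cases ?_ fun b => ?_
    · simpa using hwv
    · rw [Fin.cons_zero, Fin.cons_succ, ← hVh b, ← mul_assoc, hwh', zero_mul,
        if_neg (Fin.succ_ne_zero b).symm]
    · rw [Fin.cons_zero, Fin.cons_succ, ← hWh a, mul_assoc, hh'v, mul_zero,
        if_neg (Fin.succ_ne_zero a)]
    · simpa using hWV a b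
  · rw [Fin.sum_univ_succ]
    simp only [Fin.cons_zero, Fin.cons_succ, hsum]
    rw [hh', add_sub_cancel]

/-! ### Graded decompositions from dual systems -/

theorem isHomogeneous_of_forall_eq_sum {F R G : Type*} [Field F] [Ring R] [Algebra F R]
    [AddCommGroup G] [DecidableEq G] (ℬ : G → Submodule F R) [GradedAlgebra ℬ]
    {S : Subalgebra F R}
    (hS : ∀ x ∈ S, ∃ (κ : Type _) (s : Finset κ) (f : κ → R) (δ : κ → G),
      x = ∑ i ∈ s, f i ∧ ∀ i, f i ∈ S ∧ f i ∈ ℬ (δ i)) :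
    DirectSum.SetLike.IsHomogeneous ℬ S := by
  intro g x hx
  obtain ⟨κ, s, f, δ, rfl, hf⟩ := hS x hx
  rw [decompose_sum_coe]
  refine sum_mem fun i _ => ?_
  by_cases h : δ i = g
  · rw [DirectSum.decompose_of_mem_same ℬ (h ▸ (hf i).2)]
    exact (hf i).1
  · rw [DirectSum.decompose_of_mem_ne ℬ (hf i).2 h]
    exact S.zero_mem

/-- Multiplication by `ε` preserves degrees and is injective on `D`, so a component of `d` outside
degree `g` would survive in `ε * d`. -/
theorem mem_of_idempotent_mul_mem {F R G : Type*} [Field F] [Ring R] [Algebra F R]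
    [AddCommGroup G] [DecidableEq G] (ℬ : G → Submodule F R) [GradedAlgebra ℬ]
    {D : Subalgebra F R} (hD : DirectSum.SetLike.IsHomogeneous ℬ D) {ε : R} (hε0 : ε ∈ ℬ 0)
    (hεinj : ∀ d ∈ D, ε * d = 0 → d = 0) {d : R} (hd : d ∈ D) {g : G} (h : ε * d ∈ ℬ g) :
    d ∈ ℬ g := by
  have hz : ∀ k, k ≠ g → (DirectSum.decompose ℬ d k : R) = 0 := fun k hk => by
    refine hεinj _ (hD k hd) ?_
    rw [← DirectSum.coe_decompose_mul_of_left_mem_zero ℬ hε0,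
      DirectSum.decompose_of_mem_ne ℬ h hk.symm]
  obtain ⟨s, hs⟩ := eq_sum_decompose ℬ d
  rw [hs]
  refine Submodule.sum_mem _ fun k _ => ?_
  by_cases hk : k = g
  · rw [hk]
    exact SetLike.coe_mem _
  · rw [hz k hk]
    exact Submodule.zero_mem _

/-- The algebra homomorphism `M ↦ ∑ M a b • v a * w b` given by a complete dual system. -/
noncomputable def matrixHomOfDualSystem {F R ι : Type*} [Field F] [Ring R] [Algebra F R]
    [Fintype ι] [DecidableEq ι] {ε : R} (v w : ι → R) (hvε : ∀ a, v a * ε = v a)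
    (hwv : ∀ a b, w a * v b = if a = b then ε else 0) (hsum : ∑ a, v a * w a = 1) :
    Matrix ι ι F →ₐ[F] R :=
  AlgHom.ofLinearMap
    { toFun := fun M => ∑ a, ∑ b, M a b • (v a * w b)
      map_add' := fun M N => by simp [add_smul, Finset.sum_add_distrib]
      map_smul' := fun c M => by simp [mul_smul, Finset.smul_sum] }
    (by simp [Matrix.one_apply, hsum])
    (fun M N => by
      have key : ∀ a b c d, v a * w b * (v c * w d) = if b = c then v a * w d else 0 := by
        intro a b c d
        rw [mul_assoc, ← mul_assoc (w b), hwv]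
        split_ifs
        · rw [← mul_assoc, hvε]
        · simp
      simp only [LinearMap.coe_mk, AddHom.coe_mk, Finset.sum_mul, Finset.mul_sum, smul_mul_smul_comm,
        key, Matrix.mul_apply, Finset.sum_smul, smul_ite, smul_zero]
      simp only [Finset.sum_ite_eq', Finset.mem_univ, if_true]
      rw [Finset.sum_comm]
      conv_rhs => rw [Finset.sum_comm]
      exact Finset.sum_congr rfl fun b _ => Finset.sum_comm)

theorem matrixHomOfDualSystem_apply {F R ι : Type*} [Field F] [Ring R] [Algebra F R]
    [Fintype ι] [DecidableEq ι] {ε : R} (v w : ι → R) (hvε : ∀ a, v a * ε = v a)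
    (hwv : ∀ a b, w a * v b = if a = b then ε else 0) (hsum : ∑ a, v a * w a = 1)
    (M : Matrix ι ι F) :
    matrixHomOfDualSystem v w hvε hwv hsum M = ∑ a, ∑ b, M a b • (v a * w b) := rfl

/-- The algebra homomorphism `d ↦ ∑ v a * d * w a` given by a complete dual system. -/
noncomputable def diagonalHomOfDualSystem {F R ι : Type*} [Field F] [Ring R] [Algebra F R]
    [Fintype ι] [DecidableEq ι] {ε : R} (D : Subalgebra F R) (hεD : ∀ d ∈ D, ε * d = d * ε)
    (v w : ι → R) (hvε : ∀ a, v a * ε = v a)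
    (hwv : ∀ a b, w a * v b = if a = b then ε else 0) (hsum : ∑ a, v a * w a = 1) :
    D →ₐ[F] R :=
  AlgHom.ofLinearMap
    { toFun := fun d => ∑ a, v a * d * w a
      map_add' := fun d d' => by simp [mul_add, add_mul, Finset.sum_add_distrib]
      map_smul' := fun c d => by simp [Finset.smul_sum] }
    (by simp [hsum])
    (fun d d' => by
      simp only [LinearMap.coe_mk, AddHom.coe_mk, Subalgebra.coe_mul, Finset.sum_mul_sum]
      refine Finset.sum_congr rfl fun a _ => ?_
      have key : ∀ b, v a * d * w a * (v b * d' * w b) =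
          if a = b then v a * (d * d') * w b else 0 := by
        intro b
        rw [mul_assoc (v b), mul_assoc (v a * d), ← mul_assoc (w a), hwv]
        split_ifs
        · rw [← mul_assoc, mul_assoc (v a), ← hεD d d.2, ← mul_assoc (v a), hvε]
          simp only [mul_assoc]
        · simp
      simp [key])

theorem diagonalHomOfDualSystem_apply {F R ι : Type*} [Field F] [Ring R] [Algebra F R]
    [Fintype ι] [DecidableEq ι] {ε : R} (D : Subalgebra F R) (hεD : ∀ d ∈ D, ε * d = d * ε)
    (v w : ι → R) (hvε : ∀ a, v a * ε = v a)
    (hwv : ∀ a b, w a * v b = if a = b then ε else 0) (hsum : ∑ a, v a * w a = 1) (d : D) :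
    diagonalHomOfDualSystem D hεD v w hvε hwv hsum d = ∑ a, v a * d * w a := rfl

/-- A complete homogeneous dual system over an idempotent `ε` whose corner is `ε D`, with `D` a
matrix algebra with fine grading, gives a graded decomposition. -/
theorem exists_isGradedDecomposition_of_dualSystem {F R G : Type*} [Field F] [Ring R]
    [Algebra F R] [AddCommGroup G] [DecidableEq G] {ℬ : G → Submodule F R} [GradedAlgebra ℬ]
    {D : Subalgebra F R} (hD : IsFineGraded ℬ D) {ε : R} (hε0 : ε ∈ ℬ 0) (hε : ε ≠ 0)
    (hεD : ∀ d ∈ D, ε * d = d * ε) (hεinj : ∀ d ∈ D, ε * d = 0 → d = 0)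
    (hcorner : ∀ r, ∃ d ∈ D, ε * r * ε = ε * d) {p : ℕ} {v w : Fin p → R} {γ : Fin p → G}
    (hv : ∀ a, v a ∈ ℬ (γ a)) (hw : ∀ a, w a ∈ ℬ (-γ a))
    (hvε : ∀ a, v a * ε = v a) (hwε : ∀ a, ε * w a = w a)
    (hwv : ∀ a b, w a * v b = if a = b then ε else 0) (hsum : ∑ a, v a * w a = 1) :
    ∃ C E : Subalgebra F R, IsGradedDecomposition ℬ C E ∧ (∀ a b, v a * w b ∈ C) ∧
      ∃ θ : D ≃ₐ[F] E, IsGradedEquiv ℬ ℬ θ ∧ ∀ d, (θ d : R) = ∑ a, v a * d * w a := by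
  obtain ⟨Φ, hΦ⟩ : ∃ Φ : Matrix (Fin p) (Fin p) F →ₐ[F] R, Φ = matrixHomOfDualSystem v w hvε hwv hsum :=
    ⟨_, rfl⟩
  have hΦa : ∀ M, Φ M = ∑ a, ∑ b, M a b • (v a * w b) := fun M => by
    rw [hΦ, matrixHomOfDualSystem_apply]
  obtain ⟨Ψ, hΨ⟩ : ∃ Ψ : D →ₐ[F] R, Ψ = diagonalHomOfDualSystem D hεD v w hvε hwv hsum := ⟨_, rfl⟩
  have hΨa : ∀ d : D, Ψ d = ∑ a, v a * d * w a := fun d => by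
    rw [hΨ, diagonalHomOfDualSystem_apply]
  clear hΦ hΨ
  have hΦs : ∀ a b, Φ (Matrix.single a b 1) = v a * w b := by
    intro a b
    rw [hΦa]
    simp [Matrix.single_apply, ite_and]
  have hwvw : ∀ a b c, w a * (v b * w c) = if a = b then w c else 0 := by
    intro a b c
    rw [← mul_assoc, hwv]
    split_ifs <;> simp [hwε]
  have hΨv : ∀ (d : D) b, Ψ d * v b = v b * d := by
    intro d b
    rw [hΨa, Finset.sum_mul]
    have : ∀ a, v a * d * w a * v b = if a = b then v b * d else 0 := by
      intro a
      rw [mul_assoc, hwv]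
      split_ifs with h
      · rw [h, mul_assoc, ← hεD d d.2, ← mul_assoc, hvε]
      · simp
    simp [this]
  have hwΨ : ∀ (d : D) b, w b * Ψ d = d * w b := by
    intro d b
    rw [hΨa, Finset.mul_sum]
    have : ∀ a, w b * (v a * d * w a) = if b = a then d * w b else 0 := by
      intro a
      rw [mul_assoc (v a), ← mul_assoc, hwv]
      split_ifs with h
      · rw [h, ← mul_assoc, hεD d d.2, mul_assoc, hwε]
      · simp
    simp [this]
  have hidx : Nonempty (Fin p) := by
    by_contra h
    rw [not_nonempty_iff] at h
    rw [Finset.univ_eq_empty, Finset.sum_empty] at hsum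
    exact hε (by rw [← one_mul ε, ← hsum, zero_mul])
  obtain ⟨a₀⟩ := hidx
  -- Sandwiching between `w a` and `v b` extracts the `(a, b)` coefficient, times `ε`.
  have hΦinj : Function.Injective Φ := by
    rw [injective_iff_map_eq_zero]
    intro M hM
    ext a b
    have h1 : w a * Φ M * v b = M a b • ε := by
      rw [hΦa, Finset.mul_sum, Finset.sum_mul]
      simp only [Finset.mul_sum, Finset.sum_mul, mul_smul_comm, smul_mul_assoc, hwvw, ite_mul,
        zero_mul, hwv, smul_ite, smul_zero]
      simp
    rw [hM, mul_zero, zero_mul] at h1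
    exact (smul_eq_zero.1 h1.symm).resolve_right hε
  have hwΨv : ∀ (d : D), w a₀ * Ψ d * v a₀ = ε * d := by
    intro d
    rw [mul_assoc, hΨv, ← mul_assoc, hwv, if_pos rfl]
  have hΨinj : Function.Injective Ψ := by
    rw [injective_iff_map_eq_zero]
    intro d hd
    have h1 := hwΨv d
    rw [hd, mul_zero, zero_mul] at h1
    exact Subtype.ext (hεinj d d.2 h1.symm)
  have hΨmem : ∀ (d : D) g, (d : R) ∈ ℬ g ↔ Ψ d ∈ ℬ g := by
    intro d g
    constructor
    · intro h
      rw [hΨa]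
      refine Submodule.sum_mem _ fun a _ => ?_
      have := SetLike.mul_mem_graded (SetLike.mul_mem_graded (hv a) h) (hw a)
      rwa [add_right_comm, add_neg_cancel, zero_add] at this
    · intro h
      refine mem_of_idempotent_mul_mem ℬ hD.1 hε0 hεinj d.2 ?_
      have := SetLike.mul_mem_graded (SetLike.mul_mem_graded (hw a₀) h) (hv a₀)
      rwa [hwΨv, add_right_comm, neg_add_cancel, zero_add] at this
  have hvw : ∀ a b, v a * w b ∈ ℬ (γ a - γ b) := fun a b => by
    rw [sub_eq_add_neg]
    exact SetLike.mul_mem_graded (hv a) (hw b)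
  have hvw0 : ∀ a b, v a * w b ≠ 0 := fun a b h => by
    apply hε
    have : w a * (v a * w b) * v b = ε := by rw [hwvw, if_pos rfl, hwv, if_pos rfl]
    rw [← this, h, mul_zero, zero_mul]
  let eC : Matrix (Fin p) (Fin p) F ≃ₐ[F] Φ.range := AlgEquiv.ofInjective Φ hΦinj
  have heC : ∀ M, (eC M : R) = Φ M := fun M => AlgEquiv.ofInjective_apply Φ hΦinj M
  let θ : D ≃ₐ[F] Ψ.range := AlgEquiv.ofInjective Ψ hΨinj
  have hθ : ∀ d, (θ d : R) = Ψ d := fun d => AlgEquiv.ofInjective_apply Ψ hΨinj d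
  have hmemC : ∀ a b, v a * w b ∈ Φ.range := fun a b => ⟨_, hΦs a b⟩
  -- The unit `v i * w j` has degree `γ i - γ j`, whereas the convention is second index minus
  -- first; hence the tuple `-γ`.
  refine ⟨Φ.range, Ψ.range, ⟨⟨?_, p, eC.symm, fun a => -γ a, ?_⟩, ⟨?_, ?_, ?_⟩, ?_, ?_⟩, hmemC,
    θ, fun g d => by rw [hθ]; exact hΨmem d g, fun d => by rw [hθ, hΨa]⟩
  · apply isHomogeneous_of_forall_eq_sum
    rintro _ ⟨M, rfl⟩
    refine ⟨Fin p × Fin p, Finset.univ, fun x => M x.1 x.2 • (v x.1 * w x.2),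
      fun x => γ x.1 - γ x.2, ?_, fun x => ⟨?_, Submodule.smul_mem _ _ (hvw _ _)⟩⟩
    · change Φ M = _
      rw [hΦa, Fintype.sum_prod_type]
    · exact Subalgebra.smul_mem _ (hmemC _ _) _
  · intro i j g
    rw [AlgEquiv.symm_symm, heC, hΦs, neg_sub_neg]
    constructor
    · intro h
      exact DirectSum.degree_eq_of_mem_mem ℬ h (hvw i j) (hvw0 i j)
    · rintro rfl
      exact hvw i j
  · intro g x hx
    obtain ⟨d, rfl⟩ := hx
    change (DirectSum.decompose ℬ (Ψ d) g : R) ∈ _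
    refine ⟨⟨_, hD.1 g d.2⟩, ?_⟩
    change Ψ _ = _
    simp only [hΨa, decompose_sum_coe]
    refine Finset.sum_congr rfl fun a _ => ?_
    have h1 := DirectSum.coe_decompose_mul_add_of_right_mem ℬ (i := γ a + g) (a := v a * d) (hw a)
    have h2 := DirectSum.coe_decompose_mul_add_of_left_mem ℬ (j := g) (b := (d : R)) (hv a)
    rw [h2, add_right_comm, add_neg_cancel, zero_add] at h1
    rw [h1]
  · obtain ⟨q, ⟨e⟩⟩ := hD.2.1
    exact ⟨q, ⟨θ.symm.trans e⟩⟩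
  · intro g hg
    obtain ⟨x, hx, hx0⟩ := Submodule.exists_mem_ne_zero_of_ne_bot hg
    obtain ⟨⟨d, hxd⟩, hxg⟩ := hx
    change Ψ d = x at hxd
    subst hxd
    have hdg : (d : R) ∈ Subalgebra.toSubmodule D ⊓ ℬ g := ⟨d.2, (hΨmem d g).2 hxg⟩
    have hd0 : (⟨d, hdg⟩ : ↥(Subalgebra.toSubmodule D ⊓ ℬ g)) ≠ 0 := fun h => hx0 (by
      have : d = 0 := Subtype.ext (by simpa using congrArg Subtype.val h)
      rw [this, map_zero])
    have hfr := hD.2.2 g (fun h => hd0 (Subtype.ext ((Submodule.mem_bot F).1 (h ▸ hdg))))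
    have hall := (finrank_eq_one_iff_of_nonzero' _ hd0).1 hfr
    refine (finrank_eq_one_iff_of_nonzero'
      (⟨Ψ d, ⟨d, rfl⟩, hxg⟩ : ↥(Subalgebra.toSubmodule Ψ.range ⊓ ℬ g))
      (fun h => hx0 (congrArg Subtype.val h))).2 ?_
    rintro ⟨_, ⟨d', rfl⟩, hd'⟩
    obtain ⟨c, hc⟩ := hall ⟨d', d'.2, (hΨmem d' g).2 hd'⟩
    refine ⟨c, Subtype.ext ?_⟩
    have : c • d = d' := Subtype.ext (by simpa using congrArg Subtype.val hc)
    change c • Ψ d = Ψ d'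
    rw [← this, map_smul]
  · rintro _ ⟨M, rfl⟩ _ ⟨d, rfl⟩
    change Φ M * Ψ d = Ψ d * Φ M
    rw [hΦa]
    simp only [Finset.sum_mul, Finset.mul_sum, smul_mul_assoc, mul_smul_comm]
    refine Finset.sum_congr rfl fun a _ => Finset.sum_congr rfl fun b _ => ?_
    rw [mul_assoc, hwΨ, ← mul_assoc (Ψ d), hΨv, mul_assoc]
  · constructor
    · let m : Module.Basis (Fin p × Fin p) F ↥(Subalgebra.toSubmodule Φ.range) :=
        (Matrix.stdBasis F (Fin p) (Fin p)).map eC.toLinearEquiv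
      have hm : ∀ x, (m x : R) = v x.1 * w x.2 := by
        rintro ⟨a, b⟩
        change (eC (Matrix.stdBasis F (Fin p) (Fin p) (a, b)) : R) = _
        rw [Matrix.stdBasis_eq_single, heC, hΦs]
      refine (Submodule.LinearDisjoint.of_basis_left _ _ m ?_).injective
      rw [LinearMap.ker_eq_bot']
      intro n hn
      rw [Submodule.mulLeftMap_apply, Finsupp.sum_fintype _ _ (fun i => by simp)] at hn
      simp only [hm] at hn
      choose d hd using fun x => (n x).2
      change ∀ x, Ψ (d x) = n x at hd
      refine Finsupp.ext fun x => Subtype.ext ?_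
      rw [← hd x]
      change Ψ (d x) = 0
      have h1 : w x.1 * (∑ y, v y.1 * w y.2 * (n y : R)) * v x.2 = ε * d x := by
        rw [Finset.mul_sum, Finset.sum_mul]
        have : ∀ y, w x.1 * (v y.1 * w y.2 * (n y : R)) * v x.2 =
            if y = x then ε * d x else 0 := by
          intro y
          rw [← hd, ← mul_assoc, hwvw]
          by_cases h1 : x.1 = y.1
          · rw [if_pos h1, mul_assoc, hΨv, ← mul_assoc, hwv]
            by_cases h2 : y.2 = x.2
            · have : y = x := Prod.ext h1.symm h2
              subst this
              simp
            · rw [if_neg h2, if_neg (fun h => h2 (congrArg Prod.snd h)), zero_mul]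
          · rw [if_neg h1, if_neg (fun h => h1 (congrArg Prod.fst h).symm), zero_mul, zero_mul]
        simp [this]
      rw [hn, mul_zero, zero_mul] at h1
      have : d x = 0 := Subtype.ext (hεinj _ (d x).2 h1.symm)
      rw [this, map_zero]
    · rw [← LinearMap.range_eq_top, Submodule.mulMap_range, eq_top_iff]
      intro r _
      -- Peirce expansion: each `w a * r * v b` lies in the corner `ε R ε = ε D`, so each summand is
      -- a matrix unit times an element of the fine factor.
      have hr : r = ∑ a, ∑ b, v a * (w a * r * v b) * w b := by
        calc r = (∑ a, v a * w a) * r * ∑ b, v b * w b := by rw [hsum, one_mul, mul_one]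
          _ = _ := by
            simp only [Finset.sum_mul, Finset.mul_sum, mul_assoc]
            rw [Finset.sum_comm]
      rw [hr]
      refine Submodule.sum_mem _ fun a _ => Submodule.sum_mem _ fun b _ => ?_
      obtain ⟨d, hd, hd'⟩ := hcorner (w a * r * v b)
      have h1 : ε * (w a * r * v b) * ε = w a * r * v b := by
        rw [mul_assoc, mul_assoc _ (v b) ε, hvε, ← mul_assoc, ← mul_assoc, hwε]
      rw [h1] at hd'
      have h2 : v a * (w a * r * v b) * w b = v a * w b * Ψ ⟨d, hd⟩ := by
        rw [hd', ← mul_assoc, hvε, mul_assoc (v a) (w b), hwΨ, mul_assoc]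
      rw [h2]
      exact Submodule.mul_mem_mul (hmemC a b) ⟨⟨d, hd⟩, rfl⟩

/-! ### Centralizers and intertwiners -/

theorem IsGradedDecomposition.mem_mul {F R G : Type*} [Field F] [Ring R] [Algebra F R]
    [AddCommGroup G] [DecidableEq G] {ℬ : G → Submodule F R} [GradedAlgebra ℬ]
    {C D : Subalgebra F R} (h : IsGradedDecomposition ℬ C D) (r : R) :
    r ∈ Subalgebra.toSubmodule C * Subalgebra.toSubmodule D := by
  rw [← Submodule.mulMap_range, LinearMap.range_eq_top.2 h.bijective.2]
  exact Submodule.mem_top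

/-- The first factor contains the centralizer of the second one. -/
theorem IsGradedDecomposition.mem_of_commute {F R G : Type*} [Field F] [Ring R] [Algebra F R]
    [AddCommGroup G] [DecidableEq G] {ℬ : G → Submodule F R} [GradedAlgebra ℬ]
    {C D : Subalgebra F R} (h : IsGradedDecomposition ℬ C D) {q : Type*} [Fintype q]
    [DecidableEq q] (e : D ≃ₐ[F] Matrix q q F) (o : q) {x : R}
    (hx : ∀ d ∈ D, x * d = d * x) : x ∈ C := by
  -- Averaging over the matrix units of `D` sends `c * d` to a scalar multiple of `c`, and fixes
  -- everything that commutes with `D`.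
  have key : ∀ r : R, ∑ i, (e.symm (Matrix.single i o 1) : R) * r *
      e.symm (Matrix.single o i 1) ∈ C := by
    intro r
    refine Submodule.mul_induction_on (h.mem_mul r) ?_ ?_
    · intro c hc d hd
      have : ∑ i, (e.symm (Matrix.single i o 1) : R) * (c * d) *
          e.symm (Matrix.single o i 1) = e ⟨d, hd⟩ o o • c := by
        rw [← mul_one (e ⟨d, hd⟩ o o • c), ← matrixUnits_sum e, Finset.mul_sum]
        refine Finset.sum_congr rfl fun i _ => ?_
        rw [← mul_assoc, ← (h.commute c hc _ (SetLike.coe_mem _)).eq, mul_assoc, mul_assoc,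
          ← mul_assoc _ d, matrixUnits_corner e ⟨d, hd⟩, mul_smul_comm, smul_mul_assoc]
      rw [this]
      exact C.smul_mem hc _
    · intro r r' hr hr'
      simp only [mul_add, add_mul, Finset.sum_add_distrib]
      exact C.add_mem hr hr'
  have : x = ∑ i, (e.symm (Matrix.single i o 1) : R) * x * e.symm (Matrix.single o i 1) := by
    conv_lhs => rw [← mul_one x, ← matrixUnits_sum e, Finset.mul_sum]
    refine Finset.sum_congr rfl fun i _ => ?_
    rw [← hx _ (SetLike.coe_mem _), mul_assoc, matrixUnits_mul, if_pos rfl]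
  rw [this]
  exact key x

theorem eq_sum_matrixUnits {F R q : Type*} [Field F] [Ring R] [Algebra F R] [Fintype q]
    [DecidableEq q] {S : Subalgebra F R} (e : S ≃ₐ[F] Matrix q q F) (s : S) :
    s = ∑ i, ∑ j, e s i j • e.symm (Matrix.single i j 1) := by
  apply e.injective
  simp only [map_sum, map_smul, AlgEquiv.apply_symm_apply, Matrix.smul_single, smul_eq_mul, mul_one]
  exact Matrix.matrix_eq_sum_single _

theorem intertwines_of_matrixUnits {F R S q : Type*} [Field F] [Ring R] [Algebra F R] [Ring S]
    [Algebra F S] [Fintype q] [DecidableEq q] {D : Subalgebra F R} (e : D ≃ₐ[F] Matrix q q F)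
    (a b : D →ₗ[F] S) {v : S}
    (h : ∀ i j, a (e.symm (Matrix.single i j 1)) * v = v * b (e.symm (Matrix.single i j 1)))
    (d : D) : a d * v = v * b d := by
  rw [eq_sum_matrixUnits e d]
  simp only [map_sum, map_smul, Finset.sum_mul, Finset.mul_sum, smul_mul_assoc, mul_smul_comm, h]

/-- For homogeneous `d` of degree `k`, compare the components of degree `k + g` in `a d * v = v * b
d`; commutativity of `G` makes the same component of `v` appear on both sides. -/
theorem intertwines_decompose {F R S G : Type*} [Field F] [Ring R] [Algebra F R] [Ring S]
    [Algebra F S] [AddCommGroup G] [DecidableEq G] (𝒜 : G → Submodule F R) [GradedAlgebra 𝒜]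
    (ℬ : G → Submodule F S) [GradedAlgebra ℬ] {D : Subalgebra F R}
    (hD : DirectSum.SetLike.IsHomogeneous 𝒜 D) (a b : D →ₗ[F] S)
    (ha : ∀ g (d : D), (d : R) ∈ 𝒜 g → a d ∈ ℬ g) (hb : ∀ g (d : D), (d : R) ∈ 𝒜 g → b d ∈ ℬ g)
    {v : S} (h : ∀ d, a d * v = v * b d) (g : G) (d : D) :
    a d * (DirectSum.decompose ℬ v g : S) = DirectSum.decompose ℬ v g * b d := by
  obtain ⟨s, hs⟩ := eq_sum_decompose 𝒜 (d : R)
  have hd : d = ∑ k ∈ s, (⟨_, hD k d.2⟩ : D) := by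
    refine Subtype.ext ?_
    rw [AddSubmonoidClass.coe_finsetSum]
    exact hs
  rw [hd, map_sum, map_sum, Finset.sum_mul, Finset.mul_sum]
  refine Finset.sum_congr rfl fun k _ => ?_
  have hk := SetLike.coe_mem (DirectSum.decompose 𝒜 (d : R) k)
  rw [← DirectSum.coe_decompose_mul_add_of_left_mem ℬ (ha k ⟨_, hD k d.2⟩ hk),
    ← DirectSum.coe_decompose_mul_add_of_right_mem ℬ (hb k ⟨_, hD k d.2⟩ hk), h, add_comm]

/-! ### The graded division corner -/

/-- A matrix unit of the elementary factor generates a minimal graded corner, equal to its product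
with the fine factor. -/
theorem IsGradedDecomposition.exists_idempotent {F R G : Type*} [Field F] [Ring R] [Algebra F R]
    [Nontrivial R] [AddCommGroup G] [DecidableEq G] {ℬ : G → Submodule F R} [GradedAlgebra ℬ]
    {C D : Subalgebra F R} (h : IsGradedDecomposition ℬ C D)
    (hprime : ∀ x y : R, x ≠ 0 → y ≠ 0 → ∃ r, x * r * y ≠ 0) :
    ∃ ε ∈ ℬ 0, ε ≠ 0 ∧ ε * ε = ε ∧ (∀ d ∈ D, ε * d = d * ε) ∧ (∀ d ∈ D, ε * d = 0 → d = 0) ∧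
      (∀ r, ∃ d ∈ D, ε * r * ε = ε * d) ∧
      ∀ g, ∀ v ∈ ℬ g, v ≠ 0 → v * ε = v → ∃ y, y * v = ε := by
  obtain ⟨-, m, e, γ, hγ⟩ := h.elementary
  have hm : Nonempty (Fin m) := by
    by_contra hc
    rw [not_nonempty_iff] at hc
    have := matrixUnits_sum e
    rw [Finset.univ_eq_empty, Finset.sum_empty] at this
    exact zero_ne_one this
  obtain ⟨o⟩ := hm
  obtain ⟨ε, hε⟩ : ∃ ε : R, ε = e.symm (Matrix.single o o 1) := ⟨_, rfl⟩
  have hεC : ε ∈ C := hε ▸ SetLike.coe_mem _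
  have hε0 : ε ∈ ℬ 0 := by
    rw [hε, hγ, sub_self]
  have hεε : ε * ε = ε := by rw [hε, matrixUnits_mul, if_pos rfl]
  have hεD : ∀ d ∈ D, ε * d = d * ε := fun d hd => (h.commute ε hεC d hd).eq
  have hεinj : ∀ d ∈ D, ε * d = 0 → d = 0 := by
    intro d hd hz
    rw [← one_mul d, ← matrixUnits_sum e, Finset.sum_mul]
    refine Finset.sum_eq_zero fun i _ => ?_
    have : (e.symm (Matrix.single i i 1) : R) =
        e.symm (Matrix.single i o 1) * (ε * e.symm (Matrix.single o i 1)) := by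
      rw [hε, matrixUnits_mul, if_pos rfl, matrixUnits_mul, if_pos rfl]
    rw [this, mul_assoc, mul_assoc, (h.commute _ (SetLike.coe_mem _) d hd).eq, ← mul_assoc ε, hz,
      zero_mul, mul_zero]
  have hcorner : ∀ r, ∃ d ∈ D, ε * r * ε = ε * d := by
    intro r
    refine Submodule.mul_induction_on (h.mem_mul r) ?_ ?_
    · intro c hc d hd
      refine ⟨e ⟨c, hc⟩ o o • d, D.smul_mem hd _, ?_⟩
      have := matrixUnits_corner e ⟨c, hc⟩ o o o o
      rw [← hε] at this
      rw [mul_assoc, mul_assoc, ← hεD d hd, ← mul_assoc, ← mul_assoc, this, smul_mul_assoc,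
        mul_smul_comm]
    · rintro r r' ⟨d, hd, h1⟩ ⟨d', hd', h2⟩
      exact ⟨d + d', D.add_mem hd hd', by rw [mul_add, add_mul, h1, h2, mul_add]⟩
  have hεne : ε ≠ 0 := by
    rintro hz
    exact one_ne_zero (hεinj 1 D.one_mem (by rw [hz, zero_mul]))
  refine ⟨ε, hε0, hεne, hεε, hεD, hεinj, hcorner, ?_⟩
  intro g v hv hv0 hvε
  -- A nonzero component of `ε r v` has the form `ε t v = ε d` with `d` in `D` homogeneous, hence
  -- invertible; cancelling `d` gives `y`.
  obtain ⟨r, hr⟩ := hprime ε v hεne hv0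
  obtain ⟨k, hk⟩ := exists_decompose_ne_zero ℬ hr
  have h1 : (DirectSum.decompose ℬ (ε * r * v) k : R) =
      ε * DirectSum.decompose ℬ r (k - g) * v := by
    conv_lhs => rw [← sub_add_cancel k g]
    rw [DirectSum.coe_decompose_mul_add_of_right_mem ℬ hv,
      DirectSum.coe_decompose_mul_of_left_mem_zero ℬ hε0]
  obtain ⟨t, ht⟩ : ∃ t : R, t = DirectSum.decompose ℬ r (k - g) := ⟨_, rfl⟩
  rw [← ht] at h1
  obtain ⟨d, hd, hd'⟩ := hcorner (t * v)
  rw [← mul_assoc, mul_assoc _ v, hvε] at hd'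
  have hdk : d ∈ ℬ k := by
    refine mem_of_idempotent_mul_mem ℬ h.fine.1 hε0 hεinj hd ?_
    rw [← hd', ← h1]
    exact SetLike.coe_mem _
  have hd0 : d ≠ 0 := by
    rintro rfl
    rw [h1, hd', mul_zero] at hk
    exact hk rfl
  obtain ⟨d', hd'D, hinv⟩ := h.fine.exists_left_inverse hd hdk hd0
  refine ⟨d' * (ε * t), ?_⟩
  rw [mul_assoc, hd', ← mul_assoc, ← hεD d' hd'D, mul_assoc, hinv, mul_one]

/-! ### The adapted decomposition -/

theorem theorem3 {F G R₁ R₂ : Type*} [Field F] [AddCommGroup G] [DecidableEq G]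
    [Ring R₁] [Algebra F R₁] [Ring R₂] [Algebra F R₂]
    (𝒜 : G → Submodule F R₁) [GradedAlgebra 𝒜]
    (ℬ : G → Submodule F R₂) [GradedAlgebra ℬ]
    (k n : ℕ)
    (hR₁ : Nonempty (R₁ ≃ₐ[F] Matrix (Fin k) (Fin k) F))
    (hR₂ : Nonempty (R₂ ≃ₐ[F] Matrix (Fin n) (Fin n) F))
    (C₁ D₁ : Subalgebra F R₁) (C₂ D₂ : Subalgebra F R₂)
    (h₁ : IsGradedDecomposition 𝒜 C₁ D₁)
    (h₂ : IsGradedDecomposition ℬ C₂ D₂)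
    (hD : ∃ θ : D₁ ≃ₐ[F] D₂, IsGradedEquiv 𝒜 ℬ θ)
    (φ : R₁ →ₙₐ[F] R₂)
    (hφ_inj : Function.Injective φ)
    (hφ_graded : ∀ (g : G), ∀ x ∈ 𝒜 g, φ x ∈ ℬ g) :
    ∃ C D : Subalgebra F R₂,
      IsGradedDecomposition ℬ C D ∧
      (∃ θ : D ≃ₐ[F] D₂, IsGradedEquiv ℬ ℬ θ) ∧
      (∀ c ∈ C₁, φ c ∈ C) ∧
      ({y : R₂ | ∃ x : R₂, y = φ 1 * x * φ 1} = Set.range φ →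
        {y : R₂ | ∃ c ∈ C, y = φ 1 * c * φ 1} = φ '' (C₁ : Set R₁)) ∧
      ∃ ψ : D₁ ≃ₐ[F] D, IsGradedEquiv 𝒜 ℬ ψ ∧
        ∀ (a : R₁) (d : D₁), φ a * φ d = φ a * ψ d := by
  obtain ⟨θ, hθ⟩ := hD
  rcases subsingleton_or_nontrivial R₂ with hsub | hnt
  · refine ⟨C₂, D₂, h₂, ⟨AlgEquiv.refl, fun _ _ => Iff.rfl⟩, fun c _ => ?_, fun _ => ?_, θ, hθ,
      fun _ _ => Subsingleton.elim _ _⟩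
    · rw [Subsingleton.elim (φ c) 0]
      exact C₂.zero_mem
    · ext y
      exact ⟨fun _ => ⟨0, C₁.zero_mem, Subsingleton.elim _ _⟩,
        fun _ => ⟨0, C₂.zero_mem, Subsingleton.elim _ _⟩⟩
  have hne₁ : (1 : R₁) ≠ 0 := by
    intro h
    have h' : (1 : D₁) = 0 := Subtype.ext h
    have h'' := congrArg θ h'
    rw [map_one, map_zero] at h''
    exact one_ne_zero (congrArg Subtype.val h'' : (1 : R₂) = 0)
  obtain ⟨e⟩ := hR₂
  have hfin : FiniteDimensional F R₂ := FiniteDimensional.of_injective e.toLinearMap e.injective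
  have hprime : ∀ x y : R₂, x ≠ 0 → y ≠ 0 → ∃ r, x * r * y ≠ 0 := fun x y hx hy =>
    exists_mul_mul_ne_zero_of_algEquiv_matrix e hx hy
  obtain ⟨ε, hε0, hε, hεε, hεD, hεinj, hcorner, hdiv⟩ := h₂.exists_idempotent hprime
  obtain ⟨-, p, e₁, γ₁, hγ₁⟩ := h₁.elementary
  obtain ⟨hD₁, ⟨q, ⟨f₁⟩⟩, -⟩ := h₁.fine
  have hp : Nonempty (Fin p) := by
    by_contra hc
    rw [not_nonempty_iff] at hc
    have := matrixUnits_sum e₁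
    rw [Finset.univ_eq_empty, Finset.sum_empty] at this
    exact hne₁ this.symm
  have hq : Nonempty (Fin q) := by
    by_contra hc
    rw [not_nonempty_iff] at hc
    have := matrixUnits_sum f₁
    rw [Finset.univ_eq_empty, Finset.sum_empty] at this
    exact hne₁ this.symm
  obtain ⟨o⟩ := hp
  obtain ⟨o'⟩ := hq
  obtain ⟨E, hE⟩ : ∃ E : Fin p → Fin p → R₂,
      ∀ i j, E i j = φ (e₁.symm (Matrix.single i j 1) : R₁) := ⟨_, fun _ _ => rfl⟩
  have hEE : ∀ i j k l, E i j * E k l = if j = k then E i l else 0 := by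
    intro i j k l
    rw [hE, hE, hE, ← map_mul, matrixUnits_mul]
    split_ifs <;> simp
  have hE1 : ∑ i, E i i = φ 1 := by
    simp only [hE, ← map_sum, matrixUnits_sum]
  have hEg : ∀ i j, E i j ∈ ℬ (γ₁ j - γ₁ i) := fun i j => by
    rw [hE]
    exact hφ_graded _ _ ((hγ₁ i j _).2 rfl)
  have hED : ∀ i j (d : D₁), φ d * E i j = E i j * φ d := fun i j d => by
    rw [hE, ← map_mul, ← map_mul, (h₁.commute _ (SetLike.coe_mem _) d d.2).eq]
  have hφ1 : ∀ x, φ x * φ 1 = φ x := fun x => by rw [← map_mul, mul_one]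
  have h1φ : ∀ x, φ 1 * φ x = φ x := fun x => by rw [← map_mul, one_mul]
  have hφ10 : φ 1 ∈ ℬ 0 := hφ_graded 0 1 SetLike.GradedOne.one_mem
  have hE1l : ∀ i j, φ 1 * E i j = E i j := fun i j => by rw [hE, h1φ]
  have hE1r : ∀ i j, E i j * φ 1 = E i j := fun i j => by rw [hE, hφ1]
  let a : D₁ →ₗ[F] R₂ :=
    { toFun := fun d => φ d
      map_add' := fun x y => by simp
      map_smul' := fun c x => by simp }
  let b : D₁ →ₗ[F] R₂ := D₂.val.toLinearMap ∘ₗ θ.toLinearMap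
  have ha : ∀ g (d : D₁), (d : R₁) ∈ 𝒜 g → a d ∈ ℬ g := fun g d hd => hφ_graded g d hd
  have hb : ∀ g (d : D₁), (d : R₁) ∈ 𝒜 g → b d ∈ ℬ g := fun g d hd => (hθ g d).1 hd
  have hA : ∀ i j k l, a (f₁.symm (Matrix.single i j 1)) * a (f₁.symm (Matrix.single k l 1)) =
      if j = k then a (f₁.symm (Matrix.single i l 1)) else 0 := by
    intro i j k l
    change φ _ * φ _ = _
    rw [← map_mul, matrixUnits_mul]
    split_ifs
    · rfl
    · simp
  -- Split `E o o`, intertwining the matrix units of `φ(D₁)` with those of `D₂` transported through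
  -- `θ`.
  obtain ⟨s, v, w, γ, hv, hw, hvε, hwε, hvh, hwh, hvA, -, hwv, hsum⟩ :=
    exists_homogeneous_dual_system ℬ hprime o' (fun i j => a (f₁.symm (Matrix.single i j 1)))
      (fun i j => b (f₁.symm (Matrix.single i j 1))) hA
      (matrixUnits_mul (θ.symm.trans f₁)) (matrixUnits_sum (θ.symm.trans f₁))
      (fun v hv g i j =>
        intertwines_decompose 𝒜 ℬ hD₁ a b ha hb (intertwines_of_matrixUnits f₁ a b hv) g _)
      (fun v hv g i j =>
        intertwines_decompose 𝒜 ℬ hD₁ b a hb ha (intertwines_of_matrixUnits f₁ b a hv) g _)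
      ε hε0 hεε hε (fun i j => (hεD _ (SetLike.coe_mem _)).symm) hdiv (E o o)
      (by have := hEg o o
          rwa [sub_self] at this) (by rw [hEE, if_pos rfl])
      (fun i j => hED o o _)
      (by
        have : ∑ i, a (f₁.symm (Matrix.single i i 1)) = φ 1 := by
          rw [← matrixUnits_sum f₁, map_sum]
          rfl
        rw [this, hE1r])
  have hvD : ∀ (d : D₁) x, φ d * v x = v x * θ d := fun d x =>
    intertwines_of_matrixUnits f₁ a b (hvA x) d
  -- On the complement `1 - φ 1` nothing has to be intertwined, so both systems of matrix units are
  -- the trivial one, of size 1.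
  obtain ⟨t, v', w', γ', hv', hw', hvε', hwε', hvh', hwh', -, -, hwv', hsum'⟩ :=
    exists_homogeneous_dual_system ℬ hprime () (fun _ _ : Unit => (1 : R₂)) (fun _ _ => 1)
      (by simp) (by simp) (by simp) (by simp) (by simp)
      ε hε0 hεε hε (by simp) hdiv (1 - φ 1)
      (Submodule.sub_mem _ SetLike.GradedOne.one_mem hφ10)
      (by rw [mul_sub, sub_mul, sub_mul, hφ1]; simp) (by simp) (by simp)
  have hφv' : ∀ x, φ 1 * v' x = 0 := fun x => by
    rw [← hvh' x, ← mul_assoc, mul_sub, hφ1, mul_one, sub_self, zero_mul]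
  have hwφ' : ∀ x, w' x * φ 1 = 0 := fun x => by
    rw [← hwh' x, mul_assoc, sub_mul, hφ1, one_mul, sub_self, mul_zero]
  -- The pieces of `E o o` are carried to each `E i i` by `E i o`; those of `1 - φ 1` complete the
  -- system.
  let V : Fin p × Fin s ⊕ Fin t → R₂ := Sum.elim (fun x => E x.1 o * v x.2) v'
  let W : Fin p × Fin s ⊕ Fin t → R₂ := Sum.elim (fun x => w x.2 * E o x.1) w'
  let Γ : Fin p × Fin s ⊕ Fin t → G := Sum.elim (fun x => γ₁ o - γ₁ x.1 + γ x.2) γ'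
  have hV : ∀ x, V x ∈ ℬ (Γ x) := by
    rintro (⟨i, x⟩ | x)
    · exact SetLike.mul_mem_graded (hEg i o) (hv x)
    · exact hv' x
  have hW : ∀ x, W x ∈ ℬ (-Γ x) := by
    rintro (⟨i, x⟩ | x)
    · have := SetLike.mul_mem_graded (hw x) (hEg o i)
      rwa [show -γ x + (γ₁ i - γ₁ o) = -(γ₁ o - γ₁ i + γ x) by abel] at this
    · exact hw' x
  have hVε : ∀ x, V x * ε = V x := by
    rintro (⟨i, x⟩ | x)
    · change E i o * v x * ε = E i o * v x
      rw [mul_assoc, hvε]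
    · exact hvε' x
  have hWε : ∀ x, ε * W x = W x := by
    rintro (⟨i, x⟩ | x)
    · change ε * (w x * E o i) = w x * E o i
      rw [← mul_assoc, hwε]
    · exact hwε' x
  have hWV : ∀ x y, W x * V y = if x = y then ε else 0 := by
    rintro (⟨i, x⟩ | x) (⟨j, y⟩ | y)
    · change w x * E o i * (E j o * v y) = _
      rw [mul_assoc, ← mul_assoc (E o i), hEE]
      by_cases hij : i = j
      · rw [if_pos hij, hvh, hwv]
        simp [hij]
      · rw [if_neg hij, zero_mul, mul_zero, if_neg (by simp [hij])]
    · change w x * E o i * v' y = _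
      rw [← hE1r, mul_assoc, mul_assoc, hφv', mul_zero, mul_zero, if_neg (by simp)]
    · change w' x * (E j o * v y) = _
      rw [← hE1l, mul_assoc, ← mul_assoc (w' x), hwφ', zero_mul, if_neg (by simp)]
    · change w' x * v' y = _
      rw [hwv']
      simp
  have hEsum : ∀ i j, ∑ x, V (Sum.inl (i, x)) * W (Sum.inl (j, x)) = E i j := by
    intro i j
    calc _ = E i o * (∑ x, v x * w x) * E o j := by
          simp only [Finset.mul_sum, Finset.sum_mul, V, W, Sum.elim_inl, mul_assoc]
      _ = E i j := by rw [hsum, hEE, if_pos rfl, hEE, if_pos rfl]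
  have hVW : ∑ x, V x * W x = 1 := by
    rw [Fintype.sum_sum_type, Fintype.sum_prod_type]
    simp only [hEsum, hE1]
    change _ + ∑ x, v' x * w' x = 1
    rw [hsum', add_sub_cancel]
  let σ := Fintype.equivFin (Fin p × Fin s ⊕ Fin t)
  obtain ⟨C, D, hCD, hC, ρ, hρ, hρ'⟩ :=
    exists_isGradedDecomposition_of_dualSystem h₂.fine hε0 hε hεD hεinj hcorner
      (v := V ∘ σ.symm) (w := W ∘ σ.symm) (γ := Γ ∘ σ.symm) (fun _ => hV _) (fun _ => hW _)
      (fun _ => hVε _) (fun _ => hWε _) (fun x y => by simp [hWV])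
      ((Equiv.sum_comp σ.symm fun x => V x * W x).trans hVW)
  have hVWC : ∀ x y, V x * W y ∈ C := fun x y => by
    simpa using hC (σ x) (σ y)
  have hρV : ∀ d, (ρ d : R₂) = ∑ x, V x * d * W x := fun d =>
    (hρ' d).trans (Equiv.sum_comp σ.symm fun x => V x * d * W x)
  have hφC : ∀ c ∈ C₁, φ c ∈ C := by
    intro c hc
    have := matrixUnits_decompose e₁ ⟨c, hc⟩
    change c = _ at this
    rw [this]
    simp only [map_sum, map_smul, ← hE, ← hEsum]
    exact sum_mem fun i _ => sum_mem fun j _ =>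
      C.smul_mem (sum_mem fun x _ => hVWC _ _) _
  -- Multiplying by `φ 1` kills the complementary summands; in the others `v x * θ d = φ d * v x`
  -- pulls `φ d` out to the left.
  have hψ1 : ∀ d : D₁, φ 1 * ρ (θ d) = φ d := by
    intro d
    rw [hρV, Fintype.sum_sum_type, mul_add, Finset.mul_sum, Finset.mul_sum,
      Finset.sum_eq_zero (s := Finset.univ (α := Fin t)), add_zero, Fintype.sum_prod_type]
    · calc _ = ∑ i, φ d * E i i := by
            refine Finset.sum_congr rfl fun i _ => ?_
            rw [← hEsum, Finset.mul_sum]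
            refine Finset.sum_congr rfl fun x _ => ?_
            change φ 1 * (E i o * v x * θ d * (w x * E o i)) =
              φ d * (E i o * v x * (w x * E o i))
            rw [← mul_assoc (φ 1), ← mul_assoc (φ 1), ← mul_assoc (φ 1), hE1l, mul_assoc (E i o),
              ← hvD, ← mul_assoc (E i o), ← hED]
            simp only [mul_assoc]
        _ = φ d := by rw [← Finset.mul_sum, hE1, hφ1]
    · intro x _
      change φ 1 * (v' x * _ * _) = 0
      rw [← mul_assoc, ← mul_assoc, hφv', zero_mul, zero_mul]
  have hψ : ∀ (x : R₁) (d : D₁), φ x * φ d = φ x * ρ (θ d) := by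
    intro x d
    rw [← hψ1, ← mul_assoc, hφ1]
  refine ⟨C, D, hCD, ⟨ρ.symm, fun g d => ?_⟩, hφC, fun hrange => ?_, θ.trans ρ, fun g d => ?_, hψ⟩
  · rw [hρ g (ρ.symm d), AlgEquiv.apply_symm_apply]
  · have hφ1C : φ 1 ∈ C := hφC 1 C₁.one_mem
    ext y
    constructor
    · rintro ⟨c, hc, rfl⟩
      obtain ⟨x, hx⟩ : φ 1 * c * φ 1 ∈ Set.range φ := hrange ▸ ⟨c, rfl⟩
      -- Here `φ x` lies in `C`, so it commutes with `ρ (θ d)`, which acts as `φ d` next to `φ x`;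
      -- injectivity gives that `x` commutes with `D₁`.
      refine ⟨x, h₁.mem_of_commute f₁ o' fun d hd => hφ_inj ?_, hx⟩
      have hxC : φ x ∈ C := hx ▸ C.mul_mem (C.mul_mem hφ1C hc) hφ1C
      rw [map_mul, map_mul, hψ x ⟨d, hd⟩, (hCD.commute _ hxC _ (SetLike.coe_mem _)).eq,
        ← hψ1 ⟨d, hd⟩, (hCD.commute _ hφ1C _ (SetLike.coe_mem _)).eq, mul_assoc, h1φ]
    · rintro ⟨c, hc, rfl⟩
      exact ⟨φ c, hφC c hc, by rw [h1φ, hφ1]⟩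
  · exact (hθ g d).trans (hρ g (θ d))
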